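/- Let $P \subset \mathbb{R}^n$ be a simple polytope, i.e. the convex hull of finitely many points such that every vertex of $P$ lies on exactly $\dim P$ edges of $P$. Let $G_P$ be its vertex-edge graph, and let $\mathcal{O}$ be an acyclic orientation of $G_P$ (each edge receives exactly one direction and there is no directed cycle). For a nonempty face $F$ of $P$ (where $P$ itself counts as a face), a sink induced by $\mathcal{O}$ on $F$ is a vertex $v$ of $F$ such that no edge of $G_P$ between $v$ and another vertex of $F$ is directed away from $v$. If $\mathcal{O}$ induces exactly one sink on every $2$-dimensional face of $P$, then $\mathcal{O}$ induces exactly one sink on every nonempty face of $P$; that is, $\mathcal{O}$ is an AOF-orientation (an acyclic orientation of $G_P$ that induces a unique sink on every nonempty face of $P$). -/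

import Mathlib

namespace SimplePolytope

variable {E : Type*} [NormedAddCommGroup E] [NormedSpace ℝ E]

/-- A polytope: the convex hull of finitely many points. -/
def IsPolytope (P : Set E) : Prop :=
  ∃ S : Set E, S.Finite ∧ P = convexHull ℝ S

/-- A nonempty face of `P`: a nonempty set of the form `{x ∈ P | ℓ x = max_P ℓ}` for a linear
functional `ℓ`. The polytope `P` itself is a face (take `ℓ = 0`). -/
def IsNonemptyFace (P F : Set E) : Prop :=
  IsExposed ℝ P F ∧ F.Nonempty

/-- The dimension of the affine hull of `F` (used for nonempty `F`). -/
noncomputable def dim (F : Set E) : ℕ :=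
  Module.finrank ℝ (vectorSpan ℝ F)

/-- A `k`-face: a nonempty face of dimension `k`. -/
def IsKFace (k : ℕ) (P F : Set E) : Prop :=
  IsNonemptyFace P F ∧ dim F = k

/-- The vertices of `P`: the points `v` such that `{v}` is a face of `P`. -/
abbrev Vert (P : Set E) : Type _ := ↥(P.exposedPoints ℝ)

/-- The vertex-edge graph of `P`: two distinct vertices are adjacent when the segment joining them
is a face of `P`. -/
def graph (P : Set E) : SimpleGraph (Vert P) where
  Adj u v := u ≠ v ∧ IsExposed ℝ P (segment ℝ (u : E) (v : E))
  symm := ⟨fun u v h => ⟨h.1.symm, by rw [segment_symm]; exact h.2⟩⟩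
  loopless := ⟨fun _ h => h.1 rfl⟩

/-- A simple polytope: every vertex lies on exactly `dim P` edges. -/
def IsSimple (P : Set E) : Prop :=
  IsPolytope P ∧ ∀ v : Vert P, ((graph P).neighborSet v).encard = dim P

/-- An orientation of a graph: every edge is given exactly one of its two directions. -/
structure GraphOrientation {V : Type*} (G : SimpleGraph V) where
  /-- `Arc u v` means that the edge `uv` is directed from `u` to `v`. -/
  Arc : V → V → Prop
  adj_iff : ∀ u v, G.Adj u v ↔ Arc u v ∨ Arc v u
  asymm : ∀ u v, Arc u v → ¬ Arc v u

/-- An orientation is acyclic if it has no directed cycle, i.e. no directed path of positive length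
from a vertex to itself. -/
def GraphOrientation.IsAcyclic {V : Type*} {G : SimpleGraph V} (O : GraphOrientation G) : Prop :=
  ∀ v, ¬ Relation.TransGen O.Arc v v

/-- `v` is a sink of the orientation that `O` induces on the subgraph of `G` induced by the
vertex set `W`. -/
def GraphOrientation.IsSinkOn {V : Type*} {G : SimpleGraph V} (O : GraphOrientation G)
    (W : Set V) (v : V) : Prop :=
  v ∈ W ∧ ∀ w ∈ W, ¬ O.Arc v w

/-- The set of vertices of `P` that lie in `F`; for a face `F` these are the vertices of `F`. -/
def vertsIn (P F : Set E) : Set (Vert P) :=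
  {v | (v : E) ∈ F}

/-- `O` induces precisely one sink on the face `F`. -/
def HasUniqueSinkOn {P : Set E} (O : GraphOrientation (graph P)) (F : Set E) : Prop :=
  ∃! v : Vert P, O.IsSinkOn (vertsIn P F) v

/-- An AOF-orientation: an acyclic orientation of the graph that induces a unique sink on every
nonempty face. -/
def IsAOFOrientation {P : Set E} (O : GraphOrientation (graph P)) : Prop :=
  O.IsAcyclic ∧ ∀ F : Set E, IsNonemptyFace P F → HasUniqueSinkOn O F

end SimplePolytope

namespace SimplePolytope

variable {E : Type*} [NormedAddCommGroup E] [NormedSpace ℝ E]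

/-! The proof is Newman's lemma (local confluence implies confluence) on the graph of a face `F`. By
acyclicity and finiteness every vertex of `F` reaches a sink along arcs in `F`. If `v` has arcs to
`a` and `b` in `F`, simplicity gives a 2-face inside `F` through all three
(`IsSimple.exists_two_face`); its unique sink is reached from both `a` and `b`, so by induction `v`
reaches only one sink (`sink_eq`). Adjacent vertices then reach the same sink, and the graph of `F`
is connected (`reflTransGen_adj_of_mem_face`).

The geometry rests on `sub_mem_hull_edgeVectors`: functionals on `P` are controlled at a vertex by
their values on its edges. -/

/-- If `m` is nonpositive on the generators of a cone, then it is negative on every element of the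
cone outside of the face of the cone generated by the generators on which `m` vanishes. -/
theorem neg_or_mem_hull_of_nonpos {D : Set E} {m : E →ₗ[ℝ] ℝ} (hm : ∀ d ∈ D, m d ≤ 0) {y : E}
    (hy : y ∈ PointedCone.hull ℝ D) :
    m y < 0 ∨ (m y = 0 ∧ y ∈ PointedCone.hull ℝ {d ∈ D | m d = 0}) := by
  induction hy using Submodule.span_induction with
  | mem x hx =>
    rcases (hm x hx).lt_or_eq with h | h
    · exact Or.inl h
    · exact Or.inr ⟨h, Submodule.subset_span ⟨hx, h⟩⟩
  | zero => exact Or.inr ⟨map_zero m, Submodule.zero_mem _⟩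
  | add x y _ _ hx hy =>
    rw [map_add]
    rcases hx with hx | ⟨hx, hx'⟩ <;> rcases hy with hy | ⟨hy, hy'⟩
    · left; linarith
    · left; linarith
    · left; linarith
    · exact Or.inr ⟨by linarith, Submodule.add_mem _ hx' hy'⟩
  | smul a x _ hx =>
    have hs : m (a • x) = (a : ℝ) * m x := by
      rw [show a • x = (a : ℝ) • x from rfl, map_smul, smul_eq_mul]
    rw [hs]
    rcases hx with hx | ⟨hx, hx'⟩
    · rcases eq_or_ne a 0 with rfl | ha
      · right; simp
      · left
        have : (0 : ℝ) < a := by exact_mod_cast pos_iff_ne_zero.2 ha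
        exact mul_neg_of_pos_of_neg this hx
    · exact Or.inr ⟨by rw [hx, mul_zero], Submodule.smul_mem _ _ hx'⟩

theorem sub_mem_of_mem_convexHull {S : Set E} {v : E} {K : PointedCone ℝ E}
    (hS : ∀ s ∈ S, s - v ∈ K) {x : E} (hx : x ∈ convexHull ℝ S) : x - v ∈ K := by
  have hc : Convex ℝ ((fun x => x + -v) ⁻¹' (K : Set E)) :=
    K.convex.translate_preimage_left (-v)
  have := convexHull_min (s := S) (fun s hs => by simpa [sub_eq_add_neg] using hS s hs) hc hx
  simpa [sub_eq_add_neg] using this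

theorem isExposed_of_forall_le {P : Set E} {v : E} (hv : v ∈ P) (l : StrongDual ℝ E)
    (hl : ∀ x ∈ P, l x ≤ l v) : IsExposed ℝ P {x ∈ P | l x = l v} := by
  refine fun _ => ⟨l, Set.ext fun x => ⟨fun hx => ⟨hx.1, fun y hy => ?_⟩, fun hx => ⟨hx.1, ?_⟩⟩⟩
  · rw [hx.2]; exact hl y hy
  · exact le_antisymm (hl x hx.1) (hx.2 v hv)

/-- The extreme points of a polytope are exposed. -/
theorem extremePoints_subset_exposedPoints {S : Set E} (hS : S.Finite) :
    (convexHull ℝ S).extremePoints ℝ ⊆ (convexHull ℝ S).exposedPoints ℝ := by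
  intro e he
  have heS : e ∈ S := extremePoints_convexHull_subset he
  have hne : e ∉ convexHull ℝ (S \ {e}) := by
    intro h
    have h1 := ((convex_convexHull ℝ S).mem_extremePoints_iff_mem_sdiff_convexHull_sdiff.1 he).2
    exact h1 (convexHull_mono (Set.sdiff_subset_sdiff_left (subset_convexHull ℝ S)) h)
  obtain ⟨f, u, hf, hu⟩ := geometric_hahn_banach_closed_point (convex_convexHull ℝ (S \ {e}))
    ((hS.subset Set.sdiff_subset).isCompact_convexHull (𝕜 := ℝ)).isClosed hne
  have key : ∀ x ∈ convexHull ℝ S, f (x - e) < 0 ∨ f (x - e) = 0 ∧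
      x - e ∈ PointedCone.hull ℝ {d ∈ (fun s => s - e) '' S | f d = 0} := by
    intro x hx
    refine neg_or_mem_hull_of_nonpos (m := (f : E →ₗ[ℝ] ℝ)) (D := (fun s => s - e) '' S) ?_
      (sub_mem_of_mem_convexHull (fun s hs => Submodule.subset_span (Set.mem_image_of_mem _ hs)) hx)
    rintro _ ⟨s, hs, rfl⟩
    by_cases hse : s = e
    · simp [hse]
    · have := hf s (subset_convexHull ℝ _ ⟨hs, hse⟩)
      simp only [ContinuousLinearMap.coe_coe, map_sub]
      linarith
  refine ⟨he.1, f, fun x hx => ?_⟩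
  rcases key x hx with h | ⟨h, h'⟩
  · rw [map_sub] at h
    exact ⟨by linarith, fun h2 => by linarith⟩
  · rw [map_sub] at h
    refine ⟨by linarith, fun _ => ?_⟩
    -- Strict separation leaves only the generator `e - e = 0` in the kernel of `f`.
    have h0 : {d ∈ (fun s => s - e) '' S | f d = 0} ⊆ {0} := by
      rintro _ ⟨⟨s, hs, rfl⟩, h3⟩
      by_cases hse : s = e
      · simp [hse]
      · have := hf s (subset_convexHull ℝ _ ⟨hs, hse⟩)
        rw [map_sub] at h3
        linarith
    have h4 := Submodule.span_mono h0 h'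
    rw [Submodule.span_zero_singleton, Submodule.mem_bot] at h4
    exact sub_eq_zero.1 h4

/-! ### The cone at a vertex -/

/-- The vectors from `v` to its neighbours in the graph of `P`. -/
def edgeVectors (P : Set E) (v : Vert P) : Set E :=
  {d | ∃ w : Vert P, (graph P).Adj v w ∧ d = (w : E) - v}

/-- The rescaled generators span the vertex figure, the slice `l = 1` of the cone at `v`. An extreme
point `e` of it spans an extreme ray, which cuts `P` in an edge. -/
theorem mem_hull_edgeVectors_of_isExtreme_vertexFigure {S P : Set E} (hS : S.Finite)
    (hPS : P = convexHull ℝ S) (v : Vert P) {l : StrongDual ℝ E}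
    (hl : ∀ s ∈ S \ {(v : E)}, 0 < l (s - v)) {e : E}
    (he : e ∈ (convexHull ℝ ((fun s => (l (s - v))⁻¹ • (s - (v : E))) ''
      (S \ {(v : E)}))).extremePoints ℝ) :
    e ∈ PointedCone.hull ℝ (edgeVectors P v) := by
  set T := (fun s => (l (s - v))⁻¹ • (s - (v : E))) '' (S \ {(v : E)}) with hT
  have hvP : (v : E) ∈ P := v.2.1
  obtain ⟨-, g, hg⟩ := extremePoints_subset_exposedPoints
    ((hS.subset Set.sdiff_subset).image _) he
  obtain ⟨s₀, hs₀, hes₀⟩ := extremePoints_convexHull_subset he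
  have hle : l e = 1 := by
    rw [← hes₀]
    simp only [map_smul, smul_eq_mul]
    exact inv_mul_cancel₀ (hl s₀ hs₀).ne'
  -- On the slice `l = 1` this equals `g - g e`, so `h` is nonpositive on the whole cone and
  -- vanishes only on the ray through `e`.
  set h : StrongDual ℝ E := g - (g e) • l with hh
  have hhe : h e = 0 := by simp [hh, hle]
  have hgen : ∀ s ∈ S, h (s - v) ≤ 0 ∧ (h (s - v) = 0 → ∃ c : {c : ℝ // 0 ≤ c}, c • e = s - v) := by
    intro s hs
    by_cases hsv : s = v
    · subst hsv
      simp only [sub_self, map_zero, le_refl, true_and]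
      exact fun _ => ⟨0, by simp⟩
    have hpos := hl s ⟨hs, hsv⟩
    obtain ⟨q, hq, hqs⟩ : ∃ q ∈ T, s - v = l (s - v) • q :=
      ⟨_, ⟨s, ⟨hs, hsv⟩, rfl⟩, by simp only [smul_smul, mul_inv_cancel₀ hpos.ne', one_smul]⟩
    obtain ⟨hq1, hq2⟩ := hg q (subset_convexHull ℝ _ hq)
    have hlq : l q = 1 := by
      have := congrArg l hqs
      rw [map_smul, smul_eq_mul] at this
      exact mul_left_cancel₀ hpos.ne' (by rw [← this, mul_one])
    have hhq : h (s - v) = l (s - v) * (g q - g e) := by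
      rw [hqs]
      simp [hh, hlq]
    rw [hhq]
    refine ⟨mul_nonpos_of_nonneg_of_nonpos hpos.le (by linarith), fun h0 => ?_⟩
    have h1 : g q - g e = 0 := (mul_eq_zero.1 h0).resolve_left hpos.ne'
    have h2 : q = e := hq2 (by linarith)
    exact ⟨⟨l (s - v), hpos.le⟩, by rw [← h2]; exact hqs.symm⟩
  have key : ∀ x ∈ P, h (x - v) ≤ 0 ∧ (h (x - v) = 0 → ∃ c : {c : ℝ // 0 ≤ c}, c • e = x - v) := by
    intro x hx
    have := neg_or_mem_hull_of_nonpos (m := (h : E →ₗ[ℝ] ℝ))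
      (D := (fun s => s - (v : E)) '' S)
      (by rintro _ ⟨s, hs, rfl⟩; exact (hgen s hs).1)
      (sub_mem_of_mem_convexHull (fun s hs => Submodule.subset_span (Set.mem_image_of_mem _ hs)) (hPS ▸ hx))
    simp only [ContinuousLinearMap.coe_coe] at this
    rcases this with h1 | ⟨h1, h2⟩
    · exact ⟨h1.le, fun h3 => absurd h3 h1.ne⟩
    · refine ⟨h1.le, fun _ => Submodule.mem_span_singleton.1 (Submodule.span_le.2 ?_ h2)⟩
      rintro _ ⟨⟨s, hs, rfl⟩, h3⟩
      exact Submodule.mem_span_singleton.2 ((hgen s hs).2 h3)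
  set G := {x ∈ P | h x = h v} with hG
  have hGexp : IsExposed ℝ P G := isExposed_of_forall_le hvP h fun x hx => by
    have := (key x hx).1
    rw [map_sub] at this
    linarith
  have hGray : ∀ x ∈ G, x - v = l (x - v) • e ∧ 0 ≤ l (x - v) := by
    rintro x ⟨hx, hx'⟩
    obtain ⟨c, hc⟩ := (key x hx).2 (by rw [map_sub, hx', sub_self])
    have : l (x - v) = c := by
      rw [← hc, show c • e = (c : ℝ) • e from rfl, map_smul, hle, smul_eq_mul, mul_one]
    rw [this]
    exact ⟨hc.symm, c.2⟩
  have hvG : (v : E) ∈ G := ⟨hvP, rfl⟩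
  have hs₀G : s₀ ∈ G := by
    refine ⟨hPS ▸ subset_convexHull ℝ _ hs₀.1, ?_⟩
    have : s₀ - v = l (s₀ - v) • e := by
      rw [← hes₀]
      simp only [smul_smul, mul_inv_cancel₀ (hl s₀ hs₀).ne', one_smul]
    have h2 : h (s₀ - v) = 0 := by rw [this, map_smul, hhe, smul_zero]
    rw [map_sub] at h2
    linarith
  -- `G` lies on a ray from `v`; its far end `w` is where `l` is largest.
  obtain ⟨w, hwG, hw⟩ := (hGexp.isCompact (hPS ▸ hS.isCompact_convexHull (𝕜 := ℝ))).exists_isMaxOn ⟨_, hvG⟩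
    l.continuous.continuousOn
  have hmax : ∀ x ∈ G, l x ≤ l w := fun x hx => hw hx
  have hwpos : 0 < l (w - v) := by
    have h1 := hl s₀ hs₀
    have h2 := hmax s₀ hs₀G
    rw [map_sub] at h1 ⊢
    linarith
  have hwexp : w ∈ P.exposedPoints ℝ := by
    subst hPS
    refine extremePoints_subset_exposedPoints hS
      (hGexp.isExtreme.extremePoints_subset_extremePoints
        (exposedPoints_subset_extremePoints ⟨hwG, l, fun x hx => ⟨hmax x hx, fun hxw => ?_⟩⟩))
    have h1 : l (x - v) = l (w - v) := by
      rw [map_sub, map_sub, le_antisymm (hmax x hx) hxw]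
    have h2 := (hGray x hx).1
    rw [h1, ← (hGray w hwG).1] at h2
    exact sub_left_injective h2
  have hseg : segment ℝ (v : E) w = G := by
    refine Set.Subset.antisymm
      ((hGexp.convex (hPS ▸ convex_convexHull ℝ S)).segment_subset hvG hwG) fun x hx => ?_
    rw [segment_eq_image']
    obtain ⟨h1, h2⟩ := hGray x hx
    refine ⟨l (x - v) / l (w - v), ⟨by positivity, ?_⟩, ?_⟩
    · rw [div_le_one hwpos, map_sub, map_sub]
      linarith [hmax x hx]
    · simp only
      rw [(hGray w hwG).1, smul_smul, map_smul, hle, smul_eq_mul, mul_one,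
        div_mul_cancel₀ _ hwpos.ne', ← h1]
      abel
  have hadj : (graph P).Adj v ⟨w, hwexp⟩ := by
    refine ⟨fun hvw => ?_, by rw [hseg]; exact hGexp⟩
    have : (v : E) = w := congrArg Subtype.val hvw
    rw [this, sub_self, map_zero] at hwpos
    exact hwpos.false
  have he' : e = (⟨(l (w - v))⁻¹, (inv_pos.2 hwpos).le⟩ : {c : ℝ // 0 ≤ c}) • (w - (v : E)) := by
    change e = (l (w - v))⁻¹ • (w - (v : E))
    conv_rhs => rw [(hGray w hwG).1]
    rw [smul_smul, map_smul, hle, smul_eq_mul, mul_one, inv_mul_cancel₀ hwpos.ne', one_smul]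
  rw [he']
  exact Submodule.smul_mem _ _ (Submodule.subset_span ⟨_, hadj, rfl⟩)

/-- A polytope lies in the cone that the edges at a vertex generate. -/
theorem sub_mem_hull_edgeVectors {P : Set E} (hP : IsPolytope P) (v : Vert P) {x : E}
    (hx : x ∈ P) : x - v ∈ PointedCone.hull ℝ (edgeVectors P v) := by
  obtain ⟨S, hS, rfl⟩ := hP
  obtain ⟨hvP, l, hl⟩ := v.2
  refine sub_mem_of_mem_convexHull (fun s hs => ?_) hx
  by_cases hsv : s = v
  · simp [hsv]
  have hpos : ∀ s ∈ S \ {(v : E)}, 0 < (-l) (s - v) := by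
    rintro s ⟨hs, hsv⟩
    have := hl s (subset_convexHull ℝ _ hs)
    have h2 : ¬ l v ≤ l s := fun h => hsv (this.2 h)
    rw [neg_apply, map_sub]
    linarith
  set T := (fun s => ((-l) (s - v))⁻¹ • (s - (v : E))) '' (S \ {(v : E)}) with hT
  have hTfin : T.Finite := (hS.subset Set.sdiff_subset).image _
  have hext : ((convexHull ℝ T).extremePoints ℝ).Finite :=
    hTfin.subset extremePoints_convexHull_subset
  -- Krein–Milman; the extreme points are finitely many, so the closure can be dropped.
  have hKM := closure_convexHull_extremePoints (hTfin.isCompact_convexHull (𝕜 := ℝ))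
    (convex_convexHull ℝ T)
  rw [(hext.isCompact_convexHull (𝕜 := ℝ)).isClosed.closure_eq] at hKM
  have hsT : ((-l) (s - v))⁻¹ • (s - (v : E)) ∈ convexHull ℝ T :=
    subset_convexHull ℝ _ ⟨s, ⟨hs, hsv⟩, rfl⟩
  rw [← hKM] at hsT
  have hmem := convexHull_min
    (fun e he => mem_hull_edgeVectors_of_isExtreme_vertexFigure hS rfl v hpos he)
    (PointedCone.hull ℝ (edgeVectors (convexHull ℝ S) v)).convex hsT
  have h1 : s - (v : E) = (⟨(-l) (s - v), (hpos s ⟨hs, hsv⟩).le⟩ : {c : ℝ // 0 ≤ c}) •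
      (((-l) (s - v))⁻¹ • (s - (v : E))) := by
    change s - (v : E) = (-l) (s - v) • (((-l) (s - v))⁻¹ • (s - (v : E)))
    rw [smul_smul, mul_inv_cancel₀ (hpos s ⟨hs, hsv⟩).ne',
      one_smul]
  rw [h1]
  exact Submodule.smul_mem _ _ hmem
theorem IsPolytope.finite_vert {P : Set E} (hP : IsPolytope P) : Finite (Vert P) := by
  obtain ⟨S, hS, rfl⟩ := hP
  exact (hS.subset (exposedPoints_subset_extremePoints.trans
    extremePoints_convexHull_subset)).to_subtype

theorem IsPolytope.vertsIn_nonempty {P F : Set E} (hP : IsPolytope P) (hF : IsNonemptyFace P F) :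
    (vertsIn P F).Nonempty := by
  obtain ⟨S, hS, rfl⟩ := hP
  obtain ⟨v, hv⟩ := (hF.1.isCompact (hS.isCompact_convexHull (𝕜 := ℝ))).extremePoints_nonempty hF.2
  exact ⟨⟨v, extremePoints_subset_exposedPoints hS
    (hF.1.isExtreme.extremePoints_subset_extremePoints hv)⟩, hv.1⟩

/-! ### Connectivity of face graphs -/

/-- In a face `F`, every vertex `v` other than the vertex `t` has a neighbour on which a functional
that exposes `t` is larger. -/
theorem exists_adj_lt {P F : Set E} (hP : IsPolytope P) (hF : IsExposed ℝ P F)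
    {v t : Vert P} (hv : v ∈ vertsIn P F) (ht : t ∈ vertsIn P F) {l : StrongDual ℝ E}
    (hl : l v < l t) : ∃ w ∈ vertsIn P F, (graph P).Adj v w ∧ l v < l w := by
  by_contra! hcon
  obtain ⟨m, rfl⟩ := hF ⟨_, hv⟩
  have hmv : ∀ x ∈ P, m x ≤ m v := hv.2
  have hmt : m (t - v) = 0 := by
    rw [map_sub, le_antisymm (hmv t t.2.1) (ht.2 v v.2.1), sub_self]
  -- Since `m` exposes `F` and vanishes on `t - v`, only edges inside `F` contribute to `t - v`; if
  -- `l` increases along none of them, then `l t ≤ l v`.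
  have h1 := neg_or_mem_hull_of_nonpos (m := (m : E →ₗ[ℝ] ℝ)) (D := edgeVectors P v)
    (by
      rintro _ ⟨w, -, rfl⟩
      have := hmv w w.2.1
      simpa using this)
    (sub_mem_hull_edgeVectors hP v t.2.1)
  simp only [ContinuousLinearMap.coe_coe] at h1
  have h2 := (h1.resolve_left (by rw [hmt]; exact lt_irrefl 0)).2
  have h3 := neg_or_mem_hull_of_nonpos (m := (l : E →ₗ[ℝ] ℝ))
    (by
      rintro _ ⟨⟨w, hw, rfl⟩, hmw⟩
      rw [map_sub, sub_eq_zero] at hmw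
      have := hcon w ⟨w.2.1, fun y hy => by rw [hmw]; exact hmv y hy⟩ hw
      simpa using this) h2
  have h4 : l (t - v) ≤ 0 := by
    rcases h3 with h3 | h3
    · exact h3.le
    · exact h3.1.le
  rw [map_sub] at h4
  linarith

/-- The graph of a face is connected. -/
theorem reflTransGen_adj_of_mem_face {P F : Set E} (hP : IsPolytope P) (hF : IsExposed ℝ P F)
    {v t : Vert P} (hv : v ∈ vertsIn P F) (ht : t ∈ vertsIn P F) :
    Relation.ReflTransGen
      (fun a b => (graph P).Adj a b ∧ a ∈ vertsIn P F ∧ b ∈ vertsIn P F) v t := by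
  have := hP.finite_vert
  obtain ⟨-, l, hl⟩ := t.2
  let r : Vert P → Vert P → Prop := fun a b => l b < l a
  have : IsTrans (Vert P) r := ⟨fun a b c hab hbc => lt_trans (α := ℝ) hbc hab⟩
  have : Std.Irrefl r := ⟨fun a => lt_irrefl (l a)⟩
  have hwf : WellFounded r := Finite.wellFounded_of_trans_of_irrefl r
  induction v using hwf.induction with
  | _ v ih =>
    by_cases hvt : v = t
    · rw [hvt]
    · have hlt : l v < l t := by
        by_contra! h
        exact hvt (Subtype.ext ((hl v v.2.1).2 h))
      obtain ⟨w, hwF, hadj, hw⟩ := exists_adj_lt hP hF hv ht hlt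
      exact (ih w hw hwF).head ⟨hadj, hv, hwF⟩

/-! ### Simplicity and 2-faces -/

/-- The edge vectors at a vertex of a simple polytope are linearly independent. -/
theorem IsSimple.linearIndependent [FiniteDimensional ℝ E] {P : Set E} (hP : IsSimple P)
    (v : Vert P) :
    LinearIndependent ℝ (fun w : (graph P).neighborSet v => ((w : Vert P) : E) - v) := by
  have hfin : ((graph P).neighborSet v).Finite :=
    Set.finite_of_encard_eq_coe (hP.2 v)
  have := hfin.fintype
  rw [linearIndependent_iff_card_le_finrank_span]
  have hcard : Fintype.card ((graph P).neighborSet v) = dim P := by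
    have := hP.2 v
    rw [Set.encard_eq_coe_toFinset_card, Set.toFinset_card] at this
    exact_mod_cast this
  rw [hcard, dim, Set.finrank]
  -- There are `dim P` edge vectors, and their cone contains `P - v`, so they span the direction of
  -- `P`.
  refine Submodule.finrank_mono ?_
  rw [vectorSpan_eq_span_vsub_set_right ℝ v.2.1, Submodule.span_le]
  rintro _ ⟨x, hx, rfl⟩
  have h1 := PointedCone.hull_le_span _ _ (sub_mem_hull_edgeVectors hP.1 v hx)
  refine Submodule.span_mono ?_ h1
  rintro _ ⟨w, hw, rfl⟩
  exact ⟨⟨w, hw⟩, rfl⟩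

/-- Any two edges of a face of a simple polytope with a common vertex lie in a `2`-face of it. -/
theorem IsSimple.exists_two_face [FiniteDimensional ℝ E] {P F : Set E} (hP : IsSimple P)
    (hF : IsExposed ℝ P F) {v a b : Vert P} (hva : (graph P).Adj v a) (hvb : (graph P).Adj v b)
    (hab : a ≠ b) (hv : v ∈ vertsIn P F) (ha : a ∈ vertsIn P F) (hb : b ∈ vertsIn P F) :
    ∃ H, IsKFace 2 P H ∧ H ⊆ F ∧ (v : E) ∈ H ∧ (a : E) ∈ H ∧ (b : E) ∈ H := by
  classical
  have hli := hP.linearIndependent v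
  -- Independence allows values to be prescribed on the edges: `0` towards `a` and `b`, `-1`
  -- elsewhere, so that `m` exposes the face spanned by these two edges.
  obtain ⟨m, hm⟩ := ((Module.Basis.span hli).constr ℝ
    (fun w => if (w : Vert P) = a ∨ (w : Vert P) = b then (0 : ℝ) else -1)).exists_extend
  have hmw : ∀ w : Vert P, (graph P).Adj v w →
      m ((w : E) - v) = if w = a ∨ w = b then (0 : ℝ) else -1 := by
    intro w hw
    have h1 := (Module.Basis.span hli).constr_basis ℝ
      (fun w => if (w : Vert P) = a ∨ (w : Vert P) = b then (0 : ℝ) else -1) ⟨w, hw⟩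
    rw [← hm, LinearMap.comp_apply, Submodule.subtype_apply, Module.Basis.span_apply] at h1
    exact h1
  have hmP : ∀ x ∈ P, m (x - v) < 0 ∨ m (x - v) = 0 ∧
      x - v ∈ Submodule.span ℝ {(a : E) - v, (b : E) - v} := by
    intro x hx
    refine (neg_or_mem_hull_of_nonpos (m := m) ?_ (sub_mem_hull_edgeVectors hP.1 v hx)).imp id
      fun h => ⟨h.1, Submodule.span_mono ?_ (PointedCone.hull_le_span _ _ h.2)⟩
    · rintro _ ⟨w, hw, rfl⟩
      rw [hmw w hw]
      split_ifs <;> norm_num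
    · rintro _ ⟨⟨w, hw, rfl⟩, h0⟩
      rw [hmw w hw] at h0
      split_ifs at h0 with h
      · rcases h with rfl | rfl <;> simp
      · norm_num at h0
  set H := {x ∈ P | LinearMap.toContinuousLinearMap m x = LinearMap.toContinuousLinearMap m v}
    with hH
  have hHexp : IsExposed ℝ P H := isExposed_of_forall_le v.2.1 _ fun x hx => by
    have : m (x - v) ≤ 0 := by
      rcases hmP x hx with h | h
      · exact h.le
      · exact h.1.le
    rw [map_sub] at this
    simpa using this
  have hvH : (v : E) ∈ H := ⟨v.2.1, rfl⟩
  have haH : (a : E) ∈ H := by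
    have := hmw a hva
    rw [map_sub] at this
    exact ⟨a.2.1, by simpa [sub_eq_zero] using this⟩
  have hbH : (b : E) ∈ H := by
    have := hmw b hvb
    rw [map_sub] at this
    exact ⟨b.2.1, by simpa [sub_eq_zero] using this⟩
  refine ⟨H ∩ F, ⟨⟨hHexp.inter hF, ⟨v, hvH, hv⟩⟩, ?_⟩, Set.inter_subset_right, ⟨hvH, hv⟩,
    ⟨haH, ha⟩, ⟨hbH, hb⟩⟩
  have hspan : vectorSpan ℝ (H ∩ F) = Submodule.span ℝ {(a : E) - v, (b : E) - v} := by
    rw [vectorSpan_eq_span_vsub_set_right ℝ (show (v : E) ∈ H ∩ F from ⟨hvH, hv⟩)]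
    apply le_antisymm <;> rw [Submodule.span_le]
    · rintro _ ⟨x, ⟨⟨hxP, hx⟩, -⟩, rfl⟩
      have h0 : m (x - v) = 0 := by
        rw [map_sub, sub_eq_zero]
        simpa using hx
      exact ((hmP x hxP).resolve_left (by rw [h0]; exact lt_irrefl 0)).2
    · rintro _ (rfl | rfl)
      · exact Submodule.subset_span ⟨a, ⟨haH, ha⟩, rfl⟩
      · exact Submodule.subset_span ⟨b, ⟨hbH, hb⟩, rfl⟩
  have hli2 : LinearIndependent ℝ ![(a : E) - v, (b : E) - v] := by
    have hinj : Function.Injective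
        (![⟨a, hva⟩, ⟨b, hvb⟩] : Fin 2 → (graph P).neighborSet v) :=
      injective_pair_iff_ne.2 fun h => hab (congrArg Subtype.val h)
    have := hli.comp _ hinj
    convert this using 1
    ext i
    fin_cases i <;> rfl
  have := finrank_span_eq_card hli2
  rw [Matrix.range_cons_cons_empty, Fintype.card_fin] at this
  rw [dim, hspan, this]

/-! ### Confluence of acyclic orientations -/

section Orientation

variable {V : Type*} {G : SimpleGraph V} (O : GraphOrientation G)

/-- The arcs of `O` with both ends in `W`. -/
def GraphOrientation.ArcOn (W : Set V) (a b : V) : Prop :=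
  O.Arc a b ∧ a ∈ W ∧ b ∈ W

variable {O}

theorem GraphOrientation.IsAcyclic.wellFounded [Finite V] (hO : O.IsAcyclic) :
    WellFounded (fun a b => O.Arc b a) := by
  let r : V → V → Prop := fun a b => Relation.TransGen O.Arc b a
  have : IsTrans V r := ⟨fun a b c hab hbc => Relation.TransGen.trans hbc hab⟩
  have : Std.Irrefl r := ⟨hO⟩
  exact Subrelation.wf (fun h => Relation.TransGen.single h)
    (Finite.wellFounded_of_trans_of_irrefl r)

theorem GraphOrientation.IsAcyclic.exists_sink [Finite V] (hO : O.IsAcyclic) {W : Set V} {v : V}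
    (hv : v ∈ W) : ∃ s, O.IsSinkOn W s ∧ Relation.ReflTransGen (O.ArcOn W) v s := by
  induction v using hO.wellFounded.induction with
  | _ v ih =>
    by_cases h : ∃ w ∈ W, O.Arc v w
    · obtain ⟨w, hw, hvw⟩ := h
      obtain ⟨s, hs, hws⟩ := ih w hvw hw
      exact ⟨s, hs, hws.head ⟨hvw, hv, hw⟩⟩
    · push Not at h
      exact ⟨v, ⟨hv, h⟩, .refl⟩

theorem GraphOrientation.IsSinkOn.eq_of_reflTransGen {W : Set V} {s t : V} (hs : O.IsSinkOn W s)
    (h : Relation.ReflTransGen (O.ArcOn W) s t) : s = t := by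
  rcases h.cases_head with h | ⟨c, hc, -⟩
  · exact h
  · exact absurd hc.1 (hs.2 c hc.2.2)

/-- Local confluence implies confluence. -/
theorem GraphOrientation.IsAcyclic.sink_eq [Finite V] (hO : O.IsAcyclic) {W : Set V}
    (hloc : ∀ v a b, O.ArcOn W v a → O.ArcOn W v b → a ≠ b →
      ∃ H ⊆ W, a ∈ H ∧ b ∈ H ∧ ∃! s, O.IsSinkOn H s)
    {v s t : V} (hs : O.IsSinkOn W s) (ht : O.IsSinkOn W t)
    (hvs : Relation.ReflTransGen (O.ArcOn W) v s) (hvt : Relation.ReflTransGen (O.ArcOn W) v t) :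
    s = t := by
  induction v using hO.wellFounded.induction generalizing s t with
  | _ v ih =>
    rcases hvs.cases_head with rfl | ⟨a, hva, has⟩
    · exact hs.eq_of_reflTransGen hvt
    rcases hvt.cases_head with rfl | ⟨b, hvb, hbt⟩
    · exact (ht.eq_of_reflTransGen hvs).symm
    by_cases hab : a = b
    · exact ih a hva.1 hs ht has (hab ▸ hbt)
    obtain ⟨H, hHW, haH, hbH, z, hz, hzu⟩ := hloc v a b hva hvb hab
    have hmono : ∀ x y, O.ArcOn H x y → O.ArcOn W x y :=
      fun x y h => ⟨h.1, hHW h.2.1, hHW h.2.2⟩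
    obtain ⟨z₁, hz₁, haz⟩ := hO.exists_sink haH
    obtain ⟨z₂, hz₂, hbz⟩ := hO.exists_sink hbH
    obtain rfl := hzu z₁ hz₁
    obtain rfl := hzu z₂ hz₂
    -- `z₁` and `z₂` are the same sink of `H`, so `q` is reachable from both `a` and `b`; induction
    -- gives `s = q = t`.
    obtain ⟨q, hq, hzq⟩ := hO.exists_sink (hHW hz₁.1)
    have h1 := ih a hva.1 hs hq has ((haz.lift id hmono).trans hzq)
    have h2 := ih b hvb.1 ht hq hbt ((hbz.lift id hmono).trans hzq)
    rw [h1, h2]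

/-- The tail of an arc reaches every sink that its head reaches, and by `sink_eq` no other. The sink
reached is thus constant along undirected paths. -/
theorem GraphOrientation.IsAcyclic.existsUnique_sink [Finite V] (hO : O.IsAcyclic) {W : Set V}
    (hW : W.Nonempty)
    (hloc : ∀ v a b, O.ArcOn W v a → O.ArcOn W v b → a ≠ b →
      ∃ H ⊆ W, a ∈ H ∧ b ∈ H ∧ ∃! s, O.IsSinkOn H s)
    (hconn : ∀ v ∈ W, ∀ t ∈ W,
      Relation.ReflTransGen (fun a b => G.Adj a b ∧ a ∈ W ∧ b ∈ W) v t) :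
    ∃! s, O.IsSinkOn W s := by
  obtain ⟨v, hv⟩ := hW
  obtain ⟨s, hs, -⟩ := hO.exists_sink hv
  refine ⟨s, hs, fun t ht => ?_⟩
  have key : ∀ u, Relation.ReflTransGen (fun a b => G.Adj a b ∧ a ∈ W ∧ b ∈ W) s u →
      ∀ q, O.IsSinkOn W q → Relation.ReflTransGen (O.ArcOn W) u q → q = s := by
    intro u hu
    induction hu with
    | refl => exact fun q _ h => (hs.eq_of_reflTransGen h).symm
    | @tail b c _ hbc ih =>
      intro q hq hcq
      obtain ⟨hadj, hb, hc⟩ := hbc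
      rcases (O.adj_iff b c).1 hadj with h | h
      · exact ih q hq (hcq.head ⟨h, hb, hc⟩)
      · obtain ⟨p, hp, hbp⟩ := hO.exists_sink hb
        rw [← ih p hp hbp]
        exact hO.sink_eq hloc hq hp hcq (hbp.head ⟨h, hc, hb⟩)
  exact key t (hconn s hs.1 t ht.1) t ht .refl

end Orientation

end SimplePolytope

theorem mainTheorem2 (n : ℕ) (P : Set (EuclideanSpace ℝ (Fin n)))
    (hP : SimplePolytope.IsSimple P)
    (O : SimplePolytope.GraphOrientation (SimplePolytope.graph P))
    (hO : O.IsAcyclic)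
    (h2 : ∀ F : Set (EuclideanSpace ℝ (Fin n)),
      SimplePolytope.IsKFace 2 P F → SimplePolytope.HasUniqueSinkOn O F) :
    SimplePolytope.IsAOFOrientation O := by
  refine ⟨hO, fun F hF => ?_⟩
  have := hP.1.finite_vert
  refine hO.existsUnique_sink (hP.1.vertsIn_nonempty hF) ?_
    fun v hv t ht => SimplePolytope.reflTransGen_adj_of_mem_face hP.1 hF.1 hv ht
  rintro v a b ⟨hva, hv, ha⟩ ⟨hvb, -, hb⟩ hab
  obtain ⟨H, hH, hHF, -, haH, hbH⟩ := hP.exists_two_face hF.1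
    ((O.adj_iff v a).2 (Or.inl hva)) ((O.adj_iff v b).2 (Or.inl hvb)) hab hv ha hb
  exact ⟨SimplePolytope.vertsIn P H, fun x hx => hHF hx, haH, hbH, h2 H hH⟩
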